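/- Let $\mathcal E$ be an elementary topos, i.e. a category with finite limits in which every object $X$ has a power object: an object $\mathscr P(X)$ with a monomorphism $\in_X\rightarrowtail X\times\mathscr P(X)$ such that every subobject $N\rightarrowtail X\times Y$ is the pullback of $\in_X$ along $1_X\times n'$ for a unique arrow $n':Y\to\mathscr P(X)$, called the arrow classifying $N$ (and $N$ is the subobject classified by $n'$). Let $\{\cdot\}_X:X\to\mathscr P(X)$ be the arrow classifying the diagonal of $X\times X$. For $g:X\to Y$ let $\forall_g:\mathrm{Sub}(X)\to\mathrm{Sub}(Y)$ be the right adjoint of the pullback $g^*:\mathrm{Sub}(Y)\to\mathrm{Sub}(X)$. For an object $k:K\to Q$ of the slice $\mathcal E/Q$ we write $[k]$; for $f:P\to Q$, $f^*[k]=[f^*(k):f^*(K)\to P]$ denotes its pullback along $f$, and $k^*(f):f^*(K)\to K$ the other projection. Let $f:P\to Q$ and $h:H\to P$ be arrows of $\mathcal E$. (a) Let $\phi:P\times\mathscr P(H\times P)\to\mathscr P(H)$ be the arrow classifying $\in_{H\times P}$ regarded as a subobject of $H\times(P\times\mathscr P(H\times P))$, and let $S\rightarrowtail P\times\mathscr P(H\times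 P)$ be the pullback of $\{\cdot\}_H$ along $\phi$; in the internal language, $S=\{(p,w)\mid \exists!\,x\in H\ ((x,p)\in w)\}$. (b) Let $\tau:Q\times{\in_{H\times P}}\to Q\times\mathscr P(H\times P)$ be the inclusion into $Q\times H\times P\times\mathscr P(H\times P)$ followed by the projection. Let $T^f_1=\forall_\tau(W_1)$ and $T^h_2=\forall_\tau(W_2)$, where $W_1,W_2\rightarrowtail Q\times{\in_{H\times P}}$ are the pullbacks, along that inclusion, of the monomorphisms $\langle f\pi_P,1\rangle:H\times P\times\mathscr P(H\times P)\rightarrowtail Q\times H\times P\times\mathscr P(H\times P)$ and $1_Q\times\langle 1_H,h\rangle\times 1:Q\times H\times\mathscr P(H\times P)\rightarrowtail Q\times H\times P\times\mathscr P(H\times P)$. In the internal language, $T^f_1=\{(q,w)\mid\forall p\,\forall x\,((x,p)\in w\Rightarrow f(p)=q)\}$ and $T^h_2=\{(q,w)\mid\forall p\,\forall x\,((x,p)\in w\Rightarrow h(x)=p)\}$. Let $D=\forall_{f\times1}(S)\cap T^f_1\cap T^h_2\rightarrowtail Q\times\mathscr P(H\times P)$, regarded as an object $[D]$ of $\mathcal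 E/Q$ via the projection to $Q$. Theorem. The functor $f^*:\mathcal E/Q\to\mathcal E/P$ has a right adjoint $\prod_f$, and there are bijections, natural in the object $[k:K\to Q]$ of $\mathcal E/Q$, $$\Phi_k:\ \mathrm{Hom}_{\mathcal E/P}(f^*[k],[h])\ \cong\ \mathrm{Hom}_{\mathcal E/Q}([k],[D])$$ with the following properties. 1. $\Phi_k$ sends $\alpha$ to the arrow $[k]\to[D]$ whose composite with $D\rightarrowtail Q\times\mathscr P(H\times P)$ is $\langle k,\beta\rangle$, where $\beta:K\to\mathscr P(H\times P)$ classifies the graph $\langle\alpha,f^*(k),k^*(f)\rangle:f^*(K)\rightarrowtail H\times P\times K$ of $\alpha$. 2. Conversely, every arrow $[k]\to[D]$ has composite $\langle k,\beta\rangle$ with $D\rightarrowtail Q\times\mathscr P(H\times P)$ for some $\beta$, and $\Phi_k^{-1}$ sends it to the arrow $\alpha$ whose graph is the subobject of $H\times P\times K$ classified by $\beta$. 3. $\prod_f[h]\cong[D]$ in $\mathcal E/Q$: for every right adjoint $\prod_f$ of $f^*$ there is an isomorphism $\prod_f[h]\cong[D]$ over $Q$ that carries the bijection of the adjunction to $\Phi_k$,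 for every $k$. -/

import Mathlib

open CategoryTheory CategoryTheory.Limits

universe v u

noncomputable section

namespace ToposDepProd

theorem mk_factors_iff_exists {E : Type u} [Category.{v} E] {X Y Z : E} (f : Y ⟶ X) [Mono f]
    (g : Z ⟶ X) : (Subobject.mk f).Factors g ↔ ∃ c : Z ⟶ Y, c ≫ f = g :=
  Subobject.mk_factors_iff f g

section PowerObjects

variable {E : Type u} [Category.{v} E] [HasFiniteLimits E]

/-- A power object of `X`: an object `pow` with a monomorphism `ι : mem ⟶ X ⨯ pow` (the membership
relation) such that for every monomorphism `n : N ⟶ X ⨯ Y` there is a unique `n' : Y ⟶ pow` for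
which `n` is a pullback of `ι` along `1 ⨯ n'`. -/
structure PowerObject (X : E) where
  /-- the power object itself -/
  pow : E
  /-- the object of pairs `(x, S)` with `x ∈ S` -/
  mem : E
  /-- the membership relation -/
  ι : mem ⟶ X ⨯ pow
  mono_ι : Mono ι
  existsUnique_classifying : ∀ {N Y : E} (n : N ⟶ X ⨯ Y) [Mono n],
    ∃! n' : Y ⟶ pow, ∃ t : N ⟶ mem, IsPullback t n ι (prod.map (𝟙 X) n')

attribute [instance] PowerObject.mono_ι

namespace PowerObject

variable {X : E} (W : PowerObject X)

/-- The classifying arrow `Y ⟶ 𝒫(X)` of a monomorphism `n : N ⟶ X ⨯ Y`. -/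
def classify {N Y : E} (n : N ⟶ X ⨯ Y) [Mono n] : Y ⟶ W.pow :=
  (W.existsUnique_classifying n).choose

/-- The subobject of `X ⨯ Y` classified by `β : Y ⟶ 𝒫(X)`: the pullback of membership along
`1 ⨯ β`. -/
def classified {Y : E} (β : Y ⟶ W.pow) : Subobject (X ⨯ Y) :=
  (Subobject.pullback (prod.map (𝟙 X) β)).obj (Subobject.mk W.ι)

theorem classified_eq_iff {N Y : E} (n : N ⟶ X ⨯ Y) [Mono n] (β : Y ⟶ W.pow) :
    W.classified β = Subobject.mk n ↔ β = W.classify n := by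
  constructor
  · intro h
    replace h : (Subobject.pullback (prod.map (𝟙 X) β)).obj (Subobject.mk W.ι) =
      Subobject.mk n := h
    refine (W.existsUnique_classifying n).choose_spec.2 β ?_
    let e := Subobject.isoOfMkEq n _ h.symm
    refine ⟨e.hom ≫ Subobject.pullbackπ _ _ ≫ (Subobject.underlyingIso W.ι).hom, ?_⟩
    refine IsPullback.of_iso
      (Subobject.isPullback (prod.map (𝟙 X) β) (Subobject.mk W.ι)) e.symm
      (Subobject.underlyingIso W.ι) (Iso.refl _) (Iso.refl _) ?_ ?_ ?_ ?_
    · rw [Iso.symm_hom, Iso.inv_hom_id_assoc]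
    · simp [e]
    · simp
    · simp
  · rintro rfl
    obtain ⟨t, ht⟩ := (W.existsUnique_classifying n).choose_spec.1
    exact Subobject.pullback_obj_mk ht

theorem classified_classify {N Y : E} (n : N ⟶ X ⨯ Y) [Mono n] :
    W.classified (W.classify n) = Subobject.mk n :=
  (W.classified_eq_iff n _).2 rfl

theorem classified_injective {Y : E} {β γ : Y ⟶ W.pow} (h : W.classified β = W.classified γ) :
    β = γ := by
  have h1 := (W.classified_eq_iff (W.classified γ).arrow β).1 (by rw [h, Subobject.mk_arrow])
  have h2 := (W.classified_eq_iff (W.classified γ).arrow γ).1 (by rw [Subobject.mk_arrow])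
  rw [h1, ← h2]

theorem classified_comp {Y Z : E} (u : Z ⟶ Y) (β : Y ⟶ W.pow) :
    W.classified (u ≫ β) =
      (Subobject.pullback (prod.map (𝟙 X) u)).obj (W.classified β) := by
  unfold classified
  rw [← Subobject.pullback_comp]
  congr 2
  simp

/-- The singleton arrow `{·} : X ⟶ 𝒫(X)`, classifying the diagonal subobject of `X ⨯ X`. -/
def singleton : X ⟶ W.pow := W.classify (diag X)

instance mono_singleton : Mono W.singleton := by
  constructor
  intro Z a b hab
  have h : W.classified (a ≫ W.singleton) = W.classified (b ≫ W.singleton) := by rw [hab]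
  rw [classified_comp, classified_comp, singleton, classified_classify] at h
  have ha : ((Subobject.pullback (prod.map (𝟙 X) a)).obj (Subobject.mk (diag X))).Factors
      (prod.lift a (𝟙 Z)) := by
    rw [pullback_factors_iff, mk_factors_iff_exists]
    exact ⟨a, by simp⟩
  rw [h, pullback_factors_iff, mk_factors_iff_exists] at ha
  obtain ⟨c, hc⟩ := ha
  have h1 := congrArg (· ≫ prod.fst) hc
  have h2 := congrArg (· ≫ prod.snd) hc
  simp only [prod.comp_diag, prod.lift_map, Category.comp_id, Category.id_comp,
    prod.lift_fst, prod.lift_snd] at h1 h2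
  rw [← h1, ← h2]

end PowerObject

end PowerObjects

/-- An elementary topos: a category with finite limits and (chosen) power objects. -/
class ElementaryTopos (E : Type u) [Category.{v} E] extends HasFiniteLimits E where
  powerObject : ∀ X : E, PowerObject X

variable {E : Type u} [Category.{v} E] [ElementaryTopos E]

/-- The power object `𝒫(X)` with its membership relation. -/
abbrev powerObject (X : E) : PowerObject X := ElementaryTopos.powerObject X

/-- The underlying object of the power object of `X`. -/
abbrev Pow (X : E) : E := (powerObject X).pow

/-- The object `∈_X` of the membership relation of `X`. -/
abbrev Mem (X : E) : E := (powerObject X).mem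

/-- The monomorphism `∈_X ⟶ X ⨯ 𝒫(X)`. -/
abbrev memArrow (X : E) : Mem X ⟶ X ⨯ Pow X := (powerObject X).ι

/-- In an elementary topos, pulling back subobjects along `g` has a right adjoint. -/
instance isLeftAdjoint_subobject_pullback {X Y : E} (g : X ⟶ Y) :
    (Subobject.pullback g).IsLeftAdjoint := by
  have key : ∀ A : Subobject X, ∃ D : Subobject Y, ∀ C : Subobject Y,
      (Subobject.pullback g).obj C ≤ A ↔ C ≤ D := by
    intro A
    let W := powerObject X
    let a := W.classify (prod.lift (𝟙 X) g)
    let b := W.classify (A.arrow ≫ prod.lift (𝟙 X) g)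
    refine ⟨equalizerSubobject a b, fun C => ?_⟩
    have h1 : C ≤ equalizerSubobject a b ↔ C.arrow ≫ a = C.arrow ≫ b := by
      rw [← equalizerSubobject_factors_iff]
      exact ⟨fun h => Subobject.factors_of_le _ h (Subobject.factors_self C),
        Subobject.le_of_factors⟩
    have h2 : C.arrow ≫ a = C.arrow ≫ b ↔
        W.classified (C.arrow ≫ a) = W.classified (C.arrow ≫ b) :=
      ⟨fun h => by rw [h], W.classified_injective⟩
    rw [h1, h2, W.classified_comp, W.classified_comp, W.classified_classify,
      W.classified_classify]
    have fa : ∀ {T : E} (t : T ⟶ X ⨯ (C : E)),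
        ((Subobject.pullback (prod.map (𝟙 X) C.arrow)).obj
          (Subobject.mk (prod.lift (𝟙 X) g))).Factors t ↔
        (t ≫ prod.fst) ≫ g = (t ≫ prod.snd) ≫ C.arrow := by
      intro T t
      rw [pullback_factors_iff, mk_factors_iff_exists]
      constructor
      · rintro ⟨c, hc⟩
        have e1 := congrArg (· ≫ prod.fst) hc
        have e2 := congrArg (· ≫ prod.snd) hc
        simp only [Category.assoc, prod.map_fst, prod.map_snd, Category.comp_id, prod.lift_fst, prod.lift_snd] at e1 e2
        simp [← e1, ← e2]
      · intro h
        refine ⟨t ≫ prod.fst, ?_⟩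
        ext
        · simp [prod.lift_fst]
        · simpa [prod.lift_snd] using h
    have fb : ∀ {T : E} (t : T ⟶ X ⨯ (C : E)),
        ((Subobject.pullback (prod.map (𝟙 X) C.arrow)).obj
          (Subobject.mk (A.arrow ≫ prod.lift (𝟙 X) g))).Factors t ↔
        A.Factors (t ≫ prod.fst) ∧ (t ≫ prod.fst) ≫ g = (t ≫ prod.snd) ≫ C.arrow := by
      intro T t
      rw [pullback_factors_iff, mk_factors_iff_exists]
      constructor
      · rintro ⟨c, hc⟩
        have e1 := congrArg (· ≫ prod.fst) hc
        have e2 := congrArg (· ≫ prod.snd) hc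
        simp only [Category.assoc, prod.map_fst, prod.map_snd, Category.comp_id, prod.lift_fst, prod.lift_snd] at e1 e2
        refine ⟨?_, ?_⟩
        · rw [← e1]
          exact Subobject.factors_comp_arrow c
        · simp [← e1, ← e2]
      · rintro ⟨hA, h⟩
        refine ⟨A.factorThru _ hA, ?_⟩
        ext
        · simp [prod.lift_fst]
        · simpa [prod.lift_snd] using h
    constructor
    · intro hC
      apply le_antisymm
      · apply Subobject.le_of_factors
        have := (fa _).1 (Subobject.factors_self
          ((Subobject.pullback (prod.map (𝟙 X) C.arrow)).obj
            (Subobject.mk (prod.lift (𝟙 X) g))))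
        refine (fb _).2 ⟨Subobject.factors_of_le _ hC ?_, this⟩
        rw [pullback_factors_iff, this]
        exact Subobject.factors_comp_arrow _
      · apply Subobject.le_of_factors
        exact (fa _).2 ((fb _).1 (Subobject.factors_self _)).2
    · intro h
      apply Subobject.le_of_factors
      have hw := (Subobject.isPullback g C).w
      have := (fa (prod.lift ((Subobject.pullback g).obj C).arrow
        (Subobject.pullbackπ g C))).2 (by
          simpa [prod.lift_fst, prod.lift_snd, prod.lift_fst_assoc, prod.lift_snd_assoc] using hw.symm)
      rw [h, fb] at this
      simpa [prod.lift_fst] using this.1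
  choose R hR using key
  have gc : GaloisConnection (Subobject.pullback g).obj R := fun C A => hR A C
  exact ⟨gc.monotone_u.functor, ⟨Adjunction.mkOfHomEquiv
    { homEquiv := fun C A =>
        { toFun := fun p => homOfLE ((hR A C).1 (leOfHom p))
          invFun := fun p => homOfLE ((hR A C).2 (leOfHom p))
          left_inv := fun _ => Subsingleton.elim _ _
          right_inv := fun _ => Subsingleton.elim _ _ }
      homEquiv_naturality_left_symm := fun _ _ => Subsingleton.elim _ _
      homEquiv_naturality_right := fun _ _ => Subsingleton.elim _ _ }⟩⟩

/-- Universal quantification `∀_g`, the right adjoint of pulling back subobjects along `g`. -/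
def univ {X Y : E} (g : X ⟶ Y) : Subobject X ⥤ Subobject Y :=
  (Subobject.pullback g).rightAdjoint

theorem le_univ_iff {X Y : E} (g : X ⟶ Y) (A : Subobject X) (C : Subobject Y) :
    C ≤ (univ g).obj A ↔ (Subobject.pullback g).obj C ≤ A := by
  let adj := Adjunction.ofIsLeftAdjoint (Subobject.pullback g)
  exact ⟨fun p => leOfHom ((adj.homEquiv C A).symm (homOfLE p)),
    fun p => leOfHom (adj.homEquiv C A (homOfLE p))⟩

variable {H P Q : E}

/-- The arrow `φ : P ⨯ 𝒫(H ⨯ P) ⟶ 𝒫(H)`, `(p, w) ↦ {x | (x, p) ∈ w}`, classifying membership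
`∈_{H ⨯ P}` regarded as a subobject of `H ⨯ (P ⨯ 𝒫(H ⨯ P))`. -/
def fiberArrow (H P : E) : P ⨯ Pow (H ⨯ P) ⟶ Pow H :=
  (powerObject H).classify (memArrow (H ⨯ P) ≫ (prod.associator H P (Pow (H ⨯ P))).hom)

/-- `S = {(p, w) | ∃! x, (x, p) ∈ w}`: the pullback of `{·}_H` along `φ`. -/
def subS (H P : E) : Subobject (P ⨯ Pow (H ⨯ P)) :=
  (Subobject.pullback (fiberArrow H P)).obj (Subobject.mk (powerObject H).singleton)

/-- `τ : Q ⨯ ∈_{H ⨯ P} ⟶ Q ⨯ 𝒫(H ⨯ P)`, `(q, x, p, w) ↦ (q, w)`. -/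
def tau (H P Q : E) : Q ⨯ Mem (H ⨯ P) ⟶ Q ⨯ Pow (H ⨯ P) :=
  prod.map (𝟙 Q) (memArrow (H ⨯ P)) ≫ prod.map (𝟙 Q) prod.snd

/-- The graph `⟨f π_P, 1⟩` of `(x, p, w) ↦ f p`. -/
def graphF (H : E) (f : P ⟶ Q) :
    (H ⨯ P) ⨯ Pow (H ⨯ P) ⟶ Q ⨯ ((H ⨯ P) ⨯ Pow (H ⨯ P)) :=
  prod.lift (prod.fst ≫ prod.snd ≫ f) (𝟙 _)

instance (H : E) (f : P ⟶ Q) : Mono (graphF H f) := by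
  unfold graphF; infer_instance

/-- `W₁ = {(q, x, p, w) | (x, p) ∈ w, q = f p}`. -/
def subW₁ (H : E) (f : P ⟶ Q) : Subobject (Q ⨯ Mem (H ⨯ P)) :=
  (Subobject.pullback (prod.map (𝟙 Q) (memArrow (H ⨯ P)))).obj (Subobject.mk (graphF H f))

/-- `T₁ = {(q, w) | ∀ p x, (x, p) ∈ w → f p = q}`, constructed as `∀_τ(W₁)`. -/
def subT₁ (H : E) (f : P ⟶ Q) : Subobject (Q ⨯ Pow (H ⨯ P)) :=
  (univ (tau H P Q)).obj (subW₁ H f)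

/-- The arrow `1 ⨯ ⟨1, h⟩ ⨯ 1`, `(q, x, w) ↦ (q, x, h x, w)`. -/
def graphH (Q : E) (h : H ⟶ P) :
    Q ⨯ (H ⨯ Pow (H ⨯ P)) ⟶ Q ⨯ ((H ⨯ P) ⨯ Pow (H ⨯ P)) :=
  prod.map (𝟙 Q) (prod.map (prod.lift (𝟙 H) h) (𝟙 _))

instance (Q : E) (h : H ⟶ P) : Mono (graphH Q h) := by
  unfold graphH; infer_instance

/-- `W₂ = {(q, x, p, w) | (x, p) ∈ w, p = h x}`. -/
def subW₂ (Q : E) (h : H ⟶ P) : Subobject (Q ⨯ Mem (H ⨯ P)) :=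
  (Subobject.pullback (prod.map (𝟙 Q) (memArrow (H ⨯ P)))).obj (Subobject.mk (graphH Q h))

/-- `T₂ = {(q, w) | ∀ p x, (x, p) ∈ w → h x = p}`, constructed as `∀_τ(W₂)`. -/
def subT₂ (Q : E) (h : H ⟶ P) : Subobject (Q ⨯ Pow (H ⨯ P)) :=
  (univ (tau H P Q)).obj (subW₂ Q h)

/-- The subobject `∀_{f ⨯ 1}(S) ∩ T₁ ∩ T₂` of `Q ⨯ 𝒫(H ⨯ P)`. -/
def depSub (f : P ⟶ Q) (h : H ⟶ P) : Subobject (Q ⨯ Pow (H ⨯ P)) :=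
  (univ (prod.map f (𝟙 (Pow (H ⨯ P))))).obj (subS H P) ⊓ subT₁ H f ⊓ subT₂ Q h

/-- The object `∀_{f ⨯ 1}(S) ∩ T₁ ∩ T₂` over `Q`, via the projection to `Q`. -/
abbrev depObj (f : P ⟶ Q) (h : H ⟶ P) : Over Q :=
  Over.mk ((depSub f h).arrow ≫ prod.fst)

/-- The component `K ⟶ Q ⨯ 𝒫(H ⨯ P)` of an arrow `[k] ⟶ [∀_{f ⨯ 1}(S) ∩ T₁ ∩ T₂]` over `Q`. -/
def toProd {f : P ⟶ Q} {h : H ⟶ P} {k : Over Q} (γ : k ⟶ depObj f h) :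
    k.left ⟶ Q ⨯ Pow (H ⨯ P) :=
  γ.left ≫ (depSub f h).arrow

/-- The graph `⟨α, f^*(k), k^*(f)⟩ : f^*(K) ⟶ H ⨯ P ⨯ K` of an arrow `α : f^*[k] ⟶ [h]` over `P`;
here `f^*(K)` is the pullback of `k` and `f`. -/
def graph {f : P ⟶ Q} {h : H ⟶ P} {k : Over Q} (α : (Over.pullback f).obj k ⟶ Over.mk h) :
    pullback k.hom f ⟶ (H ⨯ P) ⨯ k.left :=
  prod.lift (prod.lift α.left (pullback.snd k.hom f)) (pullback.fst k.hom f)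

instance {f : P ⟶ Q} {h : H ⟶ P} {k : Over Q} (α : (Over.pullback f).obj k ⟶ Over.mk h) :
    Mono (graph α) := by
  constructor
  intro Z a b hab
  have h1 := congrArg (· ≫ prod.fst ≫ prod.snd) hab
  have h2 := congrArg (· ≫ prod.snd) hab
  simp only [graph, Category.assoc, prod.lift_fst_assoc, prod.lift_snd] at h1 h2
  exact pullback.hom_ext h2 h1

end ToposDepProd

end

open ToposDepProd

-- A subobject is determined by the generalized elements that factor through it, so every formula of
-- the internal language can be read as a statement about arrows `T ⟶ X`, stable under change of
-- stage. Let `β : K ⟶ 𝒫(H ⨯ P)` classify `G ↣ H ⨯ P ⨯ K`. Then `⟨k, β⟩` factors through `D` iff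
-- three conditions hold: elements `(x, p, y)` of `G` satisfy `f p = k y` (`T₁`) and `h x = p`
-- (`T₂`), and over each `(p, y)` with `f p = k y` there is exactly one `x`, at this and all later
-- stages (`∀_{f ⨯ 1}(S)`). Together they say that `G` is the graph of an arrow `f^*(K) ⟶ H` over
-- `P`. The arrow is found by evaluating the third condition at the generic point of `f^*(K)`, its
-- pair of projections (`exists_graph_eq_classified`); the other direction is
-- `depSub_factors_classify_graph`. Graphs are stable under pullback along `K' ⟶ K`, which gives
-- naturality. So `[D]` represents `Hom(f^* -, [h])`; this yields the right adjoint and, by Yoneda,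
-- the comparison with any other one.

attribute [local simp] prod.lift_fst prod.lift_snd prod.lift_fst_assoc prod.lift_snd_assoc
  pullback.lift_fst pullback.lift_snd pullback.lift_fst_assoc pullback.lift_snd_assoc

namespace ToposDepProd

/-! ### Subobjects and power objects through generalized elements -/

section Subobjects

variable {E : Type u} [Category.{v} E]

theorem subobject_le_iff_factors {X : E} (A B : Subobject X) :
    A ≤ B ↔ ∀ {T : E} (t : T ⟶ X), A.Factors t → B.Factors t :=
  ⟨fun h _ _ => Subobject.factors_of_le _ h,
    fun h => Subobject.le_of_factors (h _ (Subobject.factors_self A))⟩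

theorem subobject_ext_factors {X : E} {A B : Subobject X}
    (h : ∀ {T : E} (t : T ⟶ X), A.Factors t ↔ B.Factors t) : A = B :=
  le_antisymm ((subobject_le_iff_factors A B).2 fun t => (h t).1)
    ((subobject_le_iff_factors B A).2 fun t => (h t).2)

namespace PowerObject

variable [HasFiniteLimits E] {X : E} (W : PowerObject X)

theorem classified_factors_iff {Y T : E} (β : Y ⟶ W.pow) (t : T ⟶ X ⨯ Y) :
    (W.classified β).Factors t ↔
      (Subobject.mk W.ι).Factors (prod.lift (t ≫ prod.fst) (t ≫ prod.snd ≫ β)) := by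
  unfold classified
  rw [pullback_factors_iff]
  congr! 1
  ext <;> simp

/-- Extensionality: arrows into `𝒫(X)` agree when they classify the same subobject, and precomposing
a classifying arrow with `y` pulls its subobject back along `1 ⨯ y`. The arrow `r` is the change of
stage. -/
theorem classify_comp_eq_iff {N M Y Z T : E} (n : N ⟶ X ⨯ Y) [Mono n] (m : M ⟶ X ⨯ Z) [Mono m]
    (y : T ⟶ Y) (z : T ⟶ Z) :
    y ≫ W.classify n = z ≫ W.classify m ↔ ∀ {R : E} (x : R ⟶ X) (r : R ⟶ T),
      (Subobject.mk n).Factors (prod.lift x (r ≫ y)) ↔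
        (Subobject.mk m).Factors (prod.lift x (r ≫ z)) := by
  have key : ∀ {R : E} (t : R ⟶ X ⨯ T) {A : E} (a : T ⟶ A),
      t ≫ prod.map (𝟙 X) a = prod.lift (t ≫ prod.fst) ((t ≫ prod.snd) ≫ a) := by
    intro R t A a
    ext <;> simp
  constructor
  · intro h R x r
    have h' : (W.classified (y ≫ W.classify n)).Factors (prod.lift x r) ↔
      (W.classified (z ≫ W.classify m)).Factors (prod.lift x r) := by rw [h]
    simpa only [classified_comp, classified_classify, pullback_factors_iff, key, prod.lift_fst,
      prod.lift_snd] using h'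
  · intro h
    apply W.classified_injective
    apply subobject_ext_factors
    intro R t
    simpa only [classified_comp, classified_classify, pullback_factors_iff, key] using
      h (t ≫ prod.fst) (t ≫ prod.snd)

end PowerObject

theorem mk_lift_factors_iff [HasFiniteLimits E] {A X Y T : E} (a : A ⟶ X) (g : A ⟶ Y)
    [Mono (prod.lift a g)] (x : T ⟶ X) (y : T ⟶ Y) :
    (Subobject.mk (prod.lift a g)).Factors (prod.lift x y) ↔
      ∃ c : T ⟶ A, c ≫ a = x ∧ c ≫ g = y := by
  rw [mk_factors_iff_exists]
  refine exists_congr fun c => ?_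
  constructor
  · intro h
    exact ⟨by simpa using congrArg (· ≫ prod.fst) h, by simpa using congrArg (· ≫ prod.snd) h⟩
  · rintro ⟨rfl, rfl⟩
    ext <;> simp

theorem lift_factors_classified_iff [HasFiniteLimits E] {X Y T : E} (W : PowerObject X)
    (β : Y ⟶ W.pow) (x : T ⟶ X) (y : T ⟶ Y) :
    (W.classified β).Factors (prod.lift x y) ↔
      ∃ c : T ⟶ W.mem, c ≫ W.ι = prod.lift x (y ≫ β) := by
  rw [W.classified_factors_iff, mk_factors_iff_exists, prod.lift_fst, prod.lift_snd_assoc]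

end Subobjects

/-! ### Generalized elements of `∀_g`, `S`, `T₁`, `T₂` and `D` -/

variable {E : Type u} [Category.{v} E] [ElementaryTopos E]

/-- Universal quantification satisfies the Beck–Chevalley condition, in terms of generalized
elements. -/
theorem univ_factors_iff {X Y T : E} (g : X ⟶ Y) (A : Subobject X) (t : T ⟶ Y) :
    ((univ g).obj A).Factors t ↔
      ∀ {Z : E} (s : Z ⟶ X) (r : Z ⟶ T), s ≫ g = r ≫ t → A.Factors s := by
  let W := powerObject X
  have : Mono (prod.lift A.arrow (A.arrow ≫ g)) :=
    mono_of_mono_fac (prod.lift_fst A.arrow (A.arrow ≫ g))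
  -- `a` is `y ↦ {x | g x = y}` and `b` is `y ↦ {x ∈ A | g x = y}`. They agree at `t` iff the fibre
  -- of `g` over `t` lies in `A`, so `∀_g A` is their equalizer.
  let a := W.classify (prod.lift (𝟙 X) g)
  let b := W.classify (prod.lift A.arrow (A.arrow ≫ g))
  have key : ∀ {T : E} (t : T ⟶ Y), t ≫ a = t ≫ b ↔
      ∀ {Z : E} (s : Z ⟶ X) (r : Z ⟶ T), s ≫ g = r ≫ t → A.Factors s := by
    intro T t
    rw [W.classify_comp_eq_iff]
    refine forall_congr' fun Z => forall_congr' fun s => forall_congr' fun r => ?_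
    rw [mk_lift_factors_iff, mk_lift_factors_iff]
    constructor
    · intro h hs
      obtain ⟨c, hc, -⟩ := h.1 ⟨s, by simp, hs⟩
      rw [← hc]
      exact Subobject.factors_comp_arrow c
    · intro h
      constructor
      · rintro ⟨c, rfl, hc⟩
        have := h (by simpa using hc)
        exact ⟨A.factorThru _ this, by simp, by simpa using hc⟩
      · rintro ⟨c, rfl, hc⟩
        exact ⟨c ≫ A.arrow, by simp, by simpa using hc⟩
  have hu : (univ g).obj A = equalizerSubobject a b := by
    apply le_antisymm
    · apply Subobject.le_of_factors
      rw [equalizerSubobject_factors_iff, key]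
      intro Z s r hs
      refine Subobject.factors_of_le s ((le_univ_iff g A _).1 le_rfl) ?_
      rw [pullback_factors_iff, hs]
      exact Subobject.factors_comp_arrow r
    · rw [le_univ_iff, subobject_le_iff_factors]
      intro Z s hs
      rw [pullback_factors_iff, equalizerSubobject_factors_iff, key] at hs
      exact hs s (𝟙 Z) (by simp)
  rw [hu, equalizerSubobject_factors_iff, key]

variable {H P Q : E}

/-- The witness `x` satisfies `{x} = φ(p, β y)`, and extensionality compares the two sides at every
stage `r`. Unique existence at stage `T` alone would be weaker. -/
theorem subS_factors_iff {K T : E} (β : K ⟶ Pow (H ⨯ P)) (p : T ⟶ P) (y : T ⟶ K) :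
    (subS H P).Factors (prod.lift p (y ≫ β)) ↔
      ∃ x : T ⟶ H, ∀ {R : E} (r : R ⟶ T) (x' : R ⟶ H),
        ((powerObject (H ⨯ P)).classified β).Factors
          (prod.lift (prod.lift x' (r ≫ p)) (r ≫ y)) ↔ x' = r ≫ x := by
  unfold subS
  rw [pullback_factors_iff, mk_factors_iff_exists]
  refine exists_congr fun x => ?_
  rw [eq_comm]
  unfold fiberArrow PowerObject.singleton
  rw [PowerObject.classify_comp_eq_iff]
  have hS : ∀ {R : E} (r : R ⟶ T) (x' : R ⟶ H),
      (Subobject.mk (memArrow (H ⨯ P) ≫ (prod.associator H P (Pow (H ⨯ P))).hom)).Factors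
        (prod.lift x' (r ≫ prod.lift p (y ≫ β))) ↔
      ((powerObject (H ⨯ P)).classified β).Factors
          (prod.lift (prod.lift x' (r ≫ p)) (r ≫ y)) := by
    intro R r x'
    rw [lift_factors_classified_iff, mk_factors_iff_exists]
    refine exists_congr fun c => ?_
    rw [← Category.assoc, ← Iso.eq_comp_inv]
    congr! 1
    ext <;> simp
  have hD : ∀ {R : E} (r : R ⟶ T) (x' : R ⟶ H),
      (Subobject.mk (diag H)).Factors (prod.lift x' (r ≫ x)) ↔ x' = r ≫ x := by
    intro R r x'
    rw [mk_factors_iff_exists]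
    constructor
    · rintro ⟨c, hc⟩
      have h1 : c = x' := by simpa using congrArg (· ≫ prod.fst) hc
      have h2 : c = r ≫ x := by simpa using congrArg (· ≫ prod.snd) hc
      rw [← h1, h2]
    · rintro rfl
      exact ⟨r ≫ x, by ext <;> simp⟩
  constructor
  · intro h R r x'
    rw [← hS, ← hD]
    exact h x' r
  · intro h R x' r
    rw [hS, hD]
    exact h r x'

/-- Elements of `Q ⨯ ∈_{H ⨯ P}` lying over `⟨k, β⟩` at `y` are the triples `(x, p, y)` in the
subobject classified by `β`. This serves both `T₁` and `T₂`. -/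
theorem univ_tau_factors_iff {K : E} (A : Subobject (Q ⨯ ((H ⨯ P) ⨯ Pow (H ⨯ P)))) (k : K ⟶ Q)
    (β : K ⟶ Pow (H ⨯ P)) :
    ((univ (tau H P Q)).obj
        ((Subobject.pullback (prod.map (𝟙 Q) (memArrow (H ⨯ P)))).obj A)).Factors
        (prod.lift k β) ↔
      ∀ {R : E} (x : R ⟶ H) (p : R ⟶ P) (y : R ⟶ K),
        ((powerObject (H ⨯ P)).classified β).Factors (prod.lift (prod.lift x p) y) →
        A.Factors (prod.lift (y ≫ k) (prod.lift (prod.lift x p) (y ≫ β))) := by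
  rw [univ_factors_iff]
  constructor
  · intro hA R x p y hy
    rw [lift_factors_classified_iff] at hy
    obtain ⟨c, hc⟩ := hy
    have := hA (prod.lift (y ≫ k) c) y (by
      unfold tau
      ext
      · simp
      · have := congrArg (· ≫ prod.snd) hc
        simpa using this)
    rw [pullback_factors_iff] at this
    simpa [hc] using this
  · intro hA R s y hs
    have h1 : s ≫ prod.fst = y ≫ k := by
      simpa [tau] using congrArg (· ≫ prod.fst) hs
    have h2 : s ≫ prod.snd ≫ memArrow (H ⨯ P) ≫ prod.snd = y ≫ β := by
      simpa [tau] using congrArg (· ≫ prod.snd) hs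
    have h3 := hA (s ≫ prod.snd ≫ memArrow (H ⨯ P) ≫ prod.fst ≫ prod.fst)
      (s ≫ prod.snd ≫ memArrow (H ⨯ P) ≫ prod.fst ≫ prod.snd) y (by
        rw [lift_factors_classified_iff]
        refine ⟨s ≫ prod.snd, ?_⟩
        ext <;> simp [h2])
    rw [pullback_factors_iff]
    convert h3 using 1
    ext <;> simp [h1, h2]

theorem subT₁_factors_iff {K : E} (f : P ⟶ Q) (k : K ⟶ Q) (β : K ⟶ Pow (H ⨯ P)) :
    (subT₁ H f).Factors (prod.lift k β) ↔
      ∀ {R : E} (x : R ⟶ H) (p : R ⟶ P) (y : R ⟶ K),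
        ((powerObject (H ⨯ P)).classified β).Factors (prod.lift (prod.lift x p) y) →
        p ≫ f = y ≫ k := by
  unfold subT₁ subW₁
  rw [univ_tau_factors_iff]
  refine forall_congr' fun R => forall_congr' fun x => forall_congr' fun p =>
    forall_congr' fun y => imp_congr_right fun _ => ?_
  rw [mk_factors_iff_exists]
  unfold graphF
  constructor
  · rintro ⟨c, hc⟩
    have h1 := congrArg (· ≫ prod.fst) hc
    have h2 := congrArg (· ≫ prod.snd) hc
    simp only [Category.assoc, prod.lift_fst, prod.lift_snd, Category.comp_id] at h1 h2
    rw [h2] at h1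
    simpa using h1
  · intro h
    refine ⟨prod.lift (prod.lift x p) (y ≫ β), ?_⟩
    ext <;> simp [h]

theorem subT₂_factors_iff {K : E} (h : H ⟶ P) (k : K ⟶ Q) (β : K ⟶ Pow (H ⨯ P)) :
    (subT₂ Q h).Factors (prod.lift k β) ↔
      ∀ {R : E} (x : R ⟶ H) (p : R ⟶ P) (y : R ⟶ K),
        ((powerObject (H ⨯ P)).classified β).Factors (prod.lift (prod.lift x p) y) →
        x ≫ h = p := by
  unfold subT₂ subW₂
  rw [univ_tau_factors_iff]
  refine forall_congr' fun R => forall_congr' fun x => forall_congr' fun p =>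
    forall_congr' fun y => imp_congr_right fun _ => ?_
  rw [mk_factors_iff_exists]
  unfold graphH
  constructor
  · rintro ⟨c, hc⟩
    have h1 := congrArg (· ≫ prod.snd ≫ prod.fst ≫ prod.fst) hc
    have h2 := congrArg (· ≫ prod.snd ≫ prod.fst ≫ prod.snd) hc
    simp at h1 h2
    rw [← h1, ← h2]
    simp
  · rintro rfl
    refine ⟨prod.lift (y ≫ k) (prod.lift x (y ≫ β)), ?_⟩
    ext <;> simp

theorem univ_subS_factors_iff {K : E} (f : P ⟶ Q) (k : K ⟶ Q) (β : K ⟶ Pow (H ⨯ P)) :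
    ((univ (prod.map f (𝟙 (Pow (H ⨯ P))))).obj (subS H P)).Factors (prod.lift k β) ↔
      ∀ {T : E} (p : T ⟶ P) (y : T ⟶ K), p ≫ f = y ≫ k →
        ∃ x : T ⟶ H, ∀ {R : E} (r : R ⟶ T) (x' : R ⟶ H),
          ((powerObject (H ⨯ P)).classified β).Factors
            (prod.lift (prod.lift x' (r ≫ p)) (r ≫ y)) ↔ x' = r ≫ x := by
  rw [univ_factors_iff]
  constructor
  · intro hS T p y hp
    rw [← subS_factors_iff]
    exact hS _ y (by ext <;> simp [hp])
  · intro hS T s y hs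
    have h1 : (s ≫ prod.fst) ≫ f = y ≫ k := by simpa using congrArg (· ≫ prod.fst) hs
    have h2 : s ≫ prod.snd = y ≫ β := by simpa using congrArg (· ≫ prod.snd) hs
    have := (subS_factors_iff β _ _).2 (hS _ _ h1)
    convert this using 1
    ext <;> simp [h2]

theorem depSub_factors_iff {K : E} (f : P ⟶ Q) (h : H ⟶ P) (t : K ⟶ Q ⨯ Pow (H ⨯ P)) :
    (depSub f h).Factors t ↔
      ((univ (prod.map f (𝟙 (Pow (H ⨯ P))))).obj (subS H P)).Factors t ∧
        (subT₁ H f).Factors t ∧ (subT₂ Q h).Factors t := by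
  unfold depSub
  rw [Subobject.inf_factors, Subobject.inf_factors, and_assoc]

/-! ### Graphs of arrows over `P` and elements of `D` -/

variable {f : P ⟶ Q} {h : H ⟶ P}

theorem mk_graph_factors_iff {k : Over Q} (α : (Over.pullback f).obj k ⟶ Over.mk h) {R : E}
    (x : R ⟶ H) (p : R ⟶ P) (y : R ⟶ k.left) :
    (Subobject.mk (graph α)).Factors (prod.lift (prod.lift x p) y) ↔
      ∃ w : y ≫ k.hom = p ≫ f, x = pullback.lift y p w ≫ α.left := by
  rw [mk_factors_iff_exists]
  unfold graph
  constructor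
  · rintro ⟨c, hc⟩
    have h1 : c ≫ α.left = x := by simpa using congrArg (· ≫ prod.fst ≫ prod.fst) hc
    have h2 : c ≫ pullback.snd k.hom f = p := by
      simpa using congrArg (· ≫ prod.fst ≫ prod.snd) hc
    have h3 : c ≫ pullback.fst k.hom f = y := by simpa using congrArg (· ≫ prod.snd) hc
    refine ⟨by rw [← h2, ← h3, Category.assoc, Category.assoc, pullback.condition], ?_⟩
    rw [← h1]
    congr 1
    apply pullback.hom_ext <;> simp [h2, h3]
  · rintro ⟨w, rfl⟩
    refine ⟨pullback.lift y p w, ?_⟩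
    ext <;> simp

theorem graph_injective {k : Over Q} {α α' : (Over.pullback f).obj k ⟶ Over.mk h}
    (hα : Subobject.mk (graph α) = Subobject.mk (graph α')) : α = α' := by
  -- The generic element `(α, f^*(k), k^*(f))` of the graph of `α` also lies in that of `α'`, which
  -- forces the two values to agree.
  have h1 := (mk_graph_factors_iff α α.left (pullback.snd k.hom f) (pullback.fst k.hom f)).2
    ⟨pullback.condition, by
      rw [show pullback.lift (pullback.fst k.hom f) (pullback.snd k.hom f) pullback.condition =
        𝟙 _ by apply pullback.hom_ext <;> simp]
      simp⟩
  rw [hα, mk_graph_factors_iff] at h1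
  obtain ⟨w, hw⟩ := h1
  rw [show pullback.lift (pullback.fst k.hom f) (pullback.snd k.hom f) w =
        𝟙 _ by apply pullback.hom_ext <;> simp] at hw
  ext
  simpa using hw

theorem depSub_factors_classify_graph {k : Over Q} (α : (Over.pullback f).obj k ⟶ Over.mk h) :
    (depSub f h).Factors
      (prod.lift k.hom ((powerObject (H ⨯ P)).classify (graph α))) := by
  rw [depSub_factors_iff, univ_subS_factors_iff, subT₁_factors_iff, subT₂_factors_iff]
  simp only [PowerObject.classified_classify, mk_graph_factors_iff]
  refine ⟨fun {T} p y hp => ⟨pullback.lift y p hp.symm ≫ α.left, fun {R} r x' => ?_⟩, ?_, ?_⟩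
  · have hr : ∀ w, pullback.lift (r ≫ y) (r ≫ p) w = r ≫ pullback.lift y p hp.symm := by
      intro w
      apply pullback.hom_ext <;> simp
    constructor
    · rintro ⟨w, rfl⟩
      rw [hr, Category.assoc]
    · rintro rfl
      exact ⟨by simp [hp], by rw [hr, Category.assoc]⟩
  · rintro R x p y ⟨w, -⟩
    exact w.symm
  · rintro R x p y ⟨w, rfl⟩
    have hα : α.left ≫ h = pullback.snd k.hom f := Over.w α
    rw [Category.assoc, hα, pullback.lift_snd]

theorem exists_graph_eq_classified {k : Over Q} {β : k.left ⟶ Pow (H ⨯ P)}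
    (hβ : (depSub f h).Factors (prod.lift k.hom β)) :
    ∃ α : (Over.pullback f).obj k ⟶ Over.mk h,
      Subobject.mk (graph α) = (powerObject (H ⨯ P)).classified β := by
  rw [depSub_factors_iff, univ_subS_factors_iff, subT₁_factors_iff, subT₂_factors_iff] at hβ
  obtain ⟨hS, h₁, h₂⟩ := hβ
  -- Evaluation at the generic point of `f^*(K)` produces the underlying arrow `x` of `α`; every
  -- other compatible pair `(p, y)` is a restriction of this point.
  obtain ⟨x, hx⟩ := hS (pullback.snd k.hom f) (pullback.fst k.hom f) pullback.condition.symm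
  have hxh : x ≫ h = pullback.snd k.hom f :=
    h₂ _ _ _ (by simpa using (hx (𝟙 _) x).2 (by simp))
  refine ⟨Over.homMk x hxh, subobject_ext_factors fun {T} t => ?_⟩
  obtain ⟨x', p, y, rfl⟩ : ∃ (x' : T ⟶ H) (p : T ⟶ P) (y : T ⟶ k.left),
      t = prod.lift (prod.lift x' p) y :=
    ⟨t ≫ prod.fst ≫ prod.fst, t ≫ prod.fst ≫ prod.snd, t ≫ prod.snd, by ext <;> simp⟩
  rw [mk_graph_factors_iff]
  constructor
  · rintro ⟨w, rfl⟩
    simpa using (hx (pullback.lift y p w) _).2 rfl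
  · intro ht
    -- `T₁` makes `(y, p)` a point of `f^*(K)`; uniqueness, restricted along it, then determines
    -- `x'`.
    have w := (h₁ _ _ _ ht).symm
    exact ⟨w, (hx (pullback.lift y p w) x').1 (by simpa using ht)⟩

/-! ### Arrows into `[D]`, naturality and the adjunction -/

theorem toProd_injective {k : Over Q} {γ γ' : k ⟶ depObj f h} (hγ : toProd γ = toProd γ') :
    γ = γ' := by
  ext
  exact (cancel_mono (depSub f h).arrow).1 hγ

theorem toProd_comp {k k' : Over Q} (u : k' ⟶ k) (γ : k ⟶ depObj f h) :
    toProd (u ≫ γ) = u.left ≫ toProd γ := by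
  simp [toProd]

theorem toProd_eq_lift {k : Over Q} (γ : k ⟶ depObj f h) :
    toProd γ = prod.lift k.hom (toProd γ ≫ prod.snd) := by
  ext
  · have := Over.w γ
    simpa [toProd] using this
  · simp

theorem depSub_factors_toProd {k : Over Q} (γ : k ⟶ depObj f h) :
    (depSub f h).Factors (toProd γ) :=
  Subobject.factors_comp_arrow γ.left

/-- The graph of `α ∘ f^*(u)` is the pullback of the graph of `α` along `1 ⨯ u`. This is the content
of naturality. -/
theorem classify_graph_comp {k k' : Over Q} (u : k' ⟶ k)
    (α : (Over.pullback f).obj k ⟶ Over.mk h) :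
    (powerObject (H ⨯ P)).classify (graph ((Over.pullback f).map u ≫ α)) =
      u.left ≫ (powerObject (H ⨯ P)).classify (graph α) := by
  symm
  rw [← PowerObject.classified_eq_iff, PowerObject.classified_comp,
    PowerObject.classified_classify]
  refine subobject_ext_factors fun {T} t => ?_
  obtain ⟨x, p, y, rfl⟩ : ∃ (x : T ⟶ H) (p : T ⟶ P) (y : T ⟶ k'.left),
      t = prod.lift (prod.lift x p) y :=
    ⟨t ≫ prod.fst ≫ prod.fst, t ≫ prod.fst ≫ prod.snd, t ≫ prod.snd, by ext <;> simp⟩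
  rw [pullback_factors_iff, prod.lift_map, Category.comp_id, mk_graph_factors_iff,
    mk_graph_factors_iff]
  have key : ∀ w w', pullback.lift (y ≫ u.left) p w =
      pullback.lift y p w' ≫ ((Over.pullback f).map u).left := by
    intro w w'
    apply pullback.hom_ext <;> simp
  constructor
  · rintro ⟨w, rfl⟩
    have w' : y ≫ k'.hom = p ≫ f := by rw [← w, Category.assoc, Over.w]
    exact ⟨w', by rw [key w w', Over.comp_left, Category.assoc]⟩
  · rintro ⟨w', rfl⟩
    have w : (y ≫ u.left) ≫ k.hom = p ≫ f := by rw [← w', Category.assoc, Over.w]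
    exact ⟨w, by rw [key w w', Over.comp_left, Category.assoc]⟩

variable (f h) in
/-- The arrow over `Q` with components `k` and the classifying arrow of the graph of `α`. -/
noncomputable def ofGraph (k : Over Q) (α : (Over.pullback f).obj k ⟶ Over.mk h) :
    k ⟶ depObj f h :=
  Over.homMk ((depSub f h).factorThru _ (depSub_factors_classify_graph α)) (by simp)

theorem toProd_ofGraph (k : Over Q) (α : (Over.pullback f).obj k ⟶ Over.mk h) :
    toProd (ofGraph f h k α) =
      prod.lift k.hom ((powerObject (H ⨯ P)).classify (graph α)) := by
  simp [toProd, ofGraph]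

/-- An arrow into `[D]` is determined by its `β`, `β` by the subobject it classifies, and `α` by its
graph; the condition defining `D` makes that subobject a graph. -/
theorem ofGraph_bijective (k : Over Q) : Function.Bijective (ofGraph f h k) := by
  constructor
  · intro α α' hα
    have h1 := congrArg (toProd · ≫ prod.snd) hα
    simp only [toProd_ofGraph, prod.lift_snd] at h1
    apply graph_injective
    rw [← PowerObject.classified_classify (powerObject (H ⨯ P)), h1,
      PowerObject.classified_classify]
  · intro γ
    have h1 := depSub_factors_toProd γ
    rw [toProd_eq_lift] at h1
    obtain ⟨α, hα⟩ := exists_graph_eq_classified h1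
    refine ⟨α, toProd_injective ?_⟩
    rw [toProd_ofGraph, toProd_eq_lift γ, ← (PowerObject.classified_eq_iff _ _ _).1 hα.symm]

variable (f h) in
/-- Arrows `f^*[k] ⟶ [h]` over `P` correspond to arrows `[k] ⟶ [D]` over `Q`. -/
noncomputable def graphEquiv (k : Over Q) :
    ((Over.pullback f).obj k ⟶ Over.mk h) ≃ (k ⟶ depObj f h) :=
  Equiv.ofBijective _ (ofGraph_bijective k)

theorem toProd_graphEquiv (k : Over Q) (α : (Over.pullback f).obj k ⟶ Over.mk h) :
    toProd (graphEquiv f h k α) =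
      prod.lift k.hom ((powerObject (H ⨯ P)).classify (graph α)) :=
  toProd_ofGraph k α

theorem graphEquiv_naturality {k k' : Over Q} (u : k' ⟶ k)
    (α : (Over.pullback f).obj k ⟶ Over.mk h) :
    graphEquiv f h k' ((Over.pullback f).map u ≫ α) = u ≫ graphEquiv f h k α := by
  apply toProd_injective
  rw [toProd_comp, toProd_graphEquiv, toProd_graphEquiv, classify_graph_comp]
  ext <;> simp

/-- Representability of `Hom(f^* -, X)` for each object `X` over `P`, naturally in the first
variable, is enough: the action of the right adjoint on arrows is then forced. -/
theorem isLeftAdjoint_overPullback (f : P ⟶ Q) : (Over.pullback f).IsLeftAdjoint :=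
  (Adjunction.adjunctionOfEquivRight
    (F := Over.pullback f) (G_obj := fun X : Over P => depObj f X.hom)
    (fun k X => graphEquiv f X.hom k)
    (fun _ _ _ u α => graphEquiv_naturality u α)).isLeftAdjoint

end ToposDepProd

/-- Two natural representations of `Hom(F -, Y)`, one of them from an adjunction, have
isomorphic representing objects. -/
theorem CategoryTheory.Adjunction.exists_iso_of_homEquiv {C : Type*} [Category C] {D : Type*}
    [Category D] {F : C ⥤ D} {G : D ⥤ C} (adj : F ⊣ G) {Y : D} {Z : C}
    (e : ∀ X : C, (F.obj X ⟶ Y) ≃ (X ⟶ Z))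
    (he : ∀ (X X' : C) (u : X' ⟶ X) (a : F.obj X ⟶ Y), e X' (F.map u ≫ a) = u ≫ e X a) :
    ∃ i : G.obj Y ≅ Z, ∀ (X : C) (a : F.obj X ⟶ Y), adj.homEquiv X Y a ≫ i.hom = e X a := by
  -- Yoneda: by naturality `e` is determined by its value at the counit, the universal arrow `F (G
  -- Y) ⟶ Y`. That value is the isomorphism, and the transpose of `e⁻¹(1)` is its inverse.
  have h1 : ∀ (X : C) (a : F.obj X ⟶ Y),
      adj.homEquiv X Y a ≫ e _ (adj.counit.app Y) = e X a := by
    intro X a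
    rw [← he, ← adj.homEquiv_counit, Equiv.symm_apply_apply]
  refine ⟨⟨e _ (adj.counit.app Y), adj.homEquiv Z Y ((e Z).symm (𝟙 Z)), ?_, ?_⟩, h1⟩
  · apply (adj.homEquiv _ Y).symm.injective
    rw [← adj.homEquiv_naturality_left, Equiv.symm_apply_apply, adj.homEquiv_symm_id]
    apply (e _).injective
    rw [he, Equiv.apply_symm_apply, Category.comp_id]
  · rw [h1, Equiv.apply_symm_apply]

theorem mainTheorem1 {E : Type u} [Category.{v} E] [ElementaryTopos E] {H P Q : E}
    (f : P ⟶ Q) (h : H ⟶ P) :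
    -- the dependent product functor along `f` exists
    (Over.pullback f).IsLeftAdjoint ∧
    -- the bijective correspondence
    ∃ Φ : ∀ k : Over Q, ((Over.pullback f).obj k ⟶ Over.mk h) ≃ (k ⟶ depObj f h),
      -- naturality in `[k]`
      (∀ (k k' : Over Q) (u : k' ⟶ k) (α : (Over.pullback f).obj k ⟶ Over.mk h),
        Φ k' ((Over.pullback f).map u ≫ α) = u ≫ Φ k α) ∧
      -- `α` goes to `⟨k, β⟩`, with `β` classifying the graph of `α`
      (∀ (k : Over Q) (α : (Over.pullback f).obj k ⟶ Over.mk h),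
        toProd (Φ k α) = prod.lift k.hom ((powerObject (H ⨯ P)).classify (graph α))) ∧
      -- every arrow `[k] ⟶ ∏_f [h]` is of the form `⟨k, β⟩`, and goes to the arrow
      -- whose graph is the subobject classified by `β`
      (∀ (k : Over Q) (γ : k ⟶ depObj f h), ∃ β : k.left ⟶ Pow (H ⨯ P),
        toProd γ = prod.lift k.hom β ∧
        Subobject.mk (graph ((Φ k).symm γ)) = (powerObject (H ⨯ P)).classified β) ∧
      -- `∏_f [h] ≅ [∀_{f ⨯ 1}(S) ∩ T₁ ∩ T₂]` over `Q`, compatibly with the correspondence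
      (∀ (prodF : Over P ⥤ Over Q) (adj : Over.pullback f ⊣ prodF),
        ∃ i : prodF.obj (Over.mk h) ≅ depObj f h,
          ∀ (k : Over Q) (α : (Over.pullback f).obj k ⟶ Over.mk h),
            adj.homEquiv k (Over.mk h) α ≫ i.hom = Φ k α) := by
  refine ⟨isLeftAdjoint_overPullback f, graphEquiv f h, fun k k' u α => graphEquiv_naturality u α,
    toProd_graphEquiv, fun k γ => ⟨(powerObject (H ⨯ P)).classify (graph ((graphEquiv f h k).symm γ)),
      ?_, (PowerObject.classified_classify _ _).symm⟩,
    fun prodF adj => adj.exists_iso_of_homEquiv _ fun _ _ u α => graphEquiv_naturality u α⟩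
  rw [← toProd_graphEquiv, Equiv.apply_symm_apply]
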